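/- Consider $n\ge 2$ fermionic modes with creation operators $b_1^\dagger,\dots,b_n^\dagger$ and Fock basis $|x_1,\dots,x_n\rangle=(b_1^\dagger)^{x_1}\cdots(b_n^\dagger)^{x_n}|0\rangle$, $x_i\in\{0,1\}$. A (pure, not necessarily normalized) fermionic state is a nonzero vector $\Psi=\sum_x\psi_x|x\rangle$ of definite parity, i.e. the numbers $x_1+\dots+x_n$ with $\psi_x\ne0$ are all even or all odd. It is fully entangled if no nonempty proper subset of the modes factorizes from the remaining modes, in the sense of the fermionic product (signs from reordering the creation operators included). Let $\rho_i(\Psi)$ denote the (unnormalized) reduced state of mode $i$, a $2\times2$ matrix; a fermionic state is critical if every $\rho_i(\Psi)$ is proportional to the identity. A local diagonal operator $D_1\otimes\dots\otimes D_n$ with $D_i=\mathrm{diag}(d_{i,0},d_{i,1})$ acts by $|x\rangle\mapsto\prod_i d_{i,x_i}|x\rangle$. Let $\Psi$ be a fully entangled fermionic state. Put $\Psi^{(0)}=\Psi$ and let $\Psi^{(k+1)}$ arise from $\Psi^{(k)}$ by applying $(\det\rho)^{1/4}\rho^{-1/2}$, with $\rho=\rho_i(\Psi^{(k)})$, to the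 mode $i$ that is visited in step $k$, where the modes are visited cyclically $1,2,\dots,n,1,2,\dots$. Then: 1. every step is well defined and applies a diagonal matrix of determinant $1$, in particular an invertible one, to one mode, and the sequence $\Psi^{(k)}$ converges to a vector $\Phi$ that is either a critical state or $0$; thus $\Phi=\lambda\Psi_s$ with a critical state $\Psi_s$ and $\lambda\in\mathbb C$, where $\lambda=0$ may occur; 2. if $(D^{(k)})_k$ is any sequence of invertible local diagonal operators for which $D^{(k)}\Psi$ converges to a critical state $X$, then $X=\mu\,U\Phi$ for some $\mu\in\mathbb C$ and some local (diagonal) unitary $U$; so the critical state is unique up to local unitaries and a scalar factor, and no critical state can be reached if $\Phi=0$; 3. if moreover all the single-mode factors of all $D^{(k)}$ have determinant $1$ and $D^{(k)}\Psi$ converges to a vector $X$ that is a critical state or $0$, then $X=U\Phi$ for some local (diagonal) unitary $U$. -/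

import Mathlib

open Filter Topology

noncomputable section

/-- Vectors of the Fock space of `n` fermionic modes, given by their coefficients in the Fock basis
`(b₁†)^(x 1) ⋯ (bₙ†)^(x n) |0⟩`, equivalently by their Jordan-Wigner representation as `n`-qubit
vectors. The space is finite dimensional, so its topology is that of coefficientwise convergence. -/
abbrev FockVector (n : ℕ) : Type := (Fin n → Fin 2) → ℂ

/-- A (not necessarily normalized) pure fermionic state: a nonzero vector of definite parity, i.e.
all Fock states that occur in it have an even, or all have an odd, number of occupied modes. -/
def IsFermionicState {n : ℕ} (ψ : FockVector n) : Prop :=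
  ψ ≠ 0 ∧ ∃ p : ZMod 2, ∀ x, ψ x ≠ 0 → ((∑ i, (x i : ℕ) : ℕ) : ZMod 2) = p

/-- The sign that arises when the creation operators of the modes in `A` are moved in front of those
of the other modes (the order inside `A` and inside its complement being kept), i.e. the total sign
of the fermionic swaps `|ij⟩ ↦ (-1)^(ij) |ji⟩` that are needed. -/
def reorderSign {n : ℕ} (A : Finset (Fin n)) (x : Fin n → Fin 2) : ℂ :=
  ∏ j ∈ A, ∏ i ∈ Aᶜ.filter (fun i => i < j), (-1 : ℂ) ^ ((x i : ℕ) * (x j : ℕ))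

/-- The modes in `A` factorize from the remaining ones: `ψ` is the fermionic product of a vector `f`
of the modes in `A` and a vector `g` of the other modes. (If `ψ` is a fermionic state then `f` and
`g` automatically have definite parity.) -/
def Factorizes {n : ℕ} (ψ : FockVector n) (A : Finset (Fin n)) : Prop :=
  ∃ (f : ({i // i ∈ A} → Fin 2) → ℂ) (g : ({i // i ∈ Aᶜ} → Fin 2) → ℂ),
    ∀ x : Fin n → Fin 2, ψ x = reorderSign A x * (f (fun i => x i) * g (fun i => x i))

/-- No nonempty proper subset of the modes factorizes from the remainder. -/
def FullyEntangled {n : ℕ} (ψ : FockVector n) : Prop :=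
  ∀ A : Finset (Fin n), A.Nonempty → Aᶜ.Nonempty → ¬ Factorizes ψ A

/-- The (unnormalized) reduced state of mode `i`: the other modes are moved behind mode `i` by
fermionic swaps and then traced out of `|ψ⟩⟨ψ|`. The sum runs over the occupations of the other
modes. -/
def reducedState {n : ℕ} (ψ : FockVector n) (i : Fin n) : Matrix (Fin 2) (Fin 2) ℂ :=
  fun s t => ∑ x ∈ Finset.univ.filter (fun x : Fin n → Fin 2 => x i = 0),
    (reorderSign {i} (Function.update x i s) * ψ (Function.update x i s)) *
      (starRingEnd ℂ) (reorderSign {i} (Function.update x i t) * ψ (Function.update x i t))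

/-- All single-mode reduced states are proportional to the identity. The zero vector satisfies this
trivially; a critical state is a fermionic state (in particular nonzero) with this property. -/
def IsCritical {n : ℕ} (ψ : FockVector n) : Prop :=
  ∀ i, ∃ c : ℂ, reducedState ψ i = c • (1 : Matrix (Fin 2) (Fin 2) ℂ)

/-- A local diagonal operator `D₁ ⊗ ⋯ ⊗ Dₙ`, given by the diagonals `d i = (d i 0, d i 1)` of the
`2 × 2` matrices `D i = diag (d i 0, d i 1)`. -/
abbrev LocalDiagonal (n : ℕ) : Type := Fin n → Fin 2 → ℂ

namespace LocalDiagonal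

variable {n : ℕ}

/-- The action of `D₁ ⊗ ⋯ ⊗ Dₙ`. -/
def act (d : LocalDiagonal n) (ψ : FockVector n) : FockVector n :=
  fun x => (∏ i, d i (x i)) * ψ x

/-- All `D i` are invertible. -/
def IsInvertible (d : LocalDiagonal n) : Prop := ∀ i s, d i s ≠ 0

/-- All `D i` have determinant one (so they are invertible). -/
def IsDetOne (d : LocalDiagonal n) : Prop := ∀ i, d i 0 * d i 1 = 1

/-- All `D i` are unitary. -/
def IsUnitary (d : LocalDiagonal n) : Prop := ∀ i s, ‖d i s‖ = 1

end LocalDiagonal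

/-- The local operator that acts as `|ρ|^(1/4) (√ρ)⁻¹` on mode `i`, where `ρ` is the reduced state
of mode `i` of `ψ` (a diagonal matrix when `ψ` is a fermionic state) and `|ρ|` its determinant, and
as the identity on all other modes. It does not change when `ψ` is rescaled. -/
def balancingOperator {n : ℕ} (ψ : FockVector n) (i : Fin n) : LocalDiagonal n :=
  Function.update (fun _ _ => 1) i fun s =>
    (((reducedState ψ i).det.re ^ (1 / 4 : ℝ) / Real.sqrt ((reducedState ψ i) s s).re : ℝ) : ℂ)

/-- The mode that is treated in step `k`: the modes are visited cyclically. -/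
def stepMode (n : ℕ) [NeZero n] (k : ℕ) : Fin n := Fin.ofNat n k

/-- The iteration that starts with `ψ` and, in step `k`, applies the balancing operator of the
mode `k mod n` to the current vector. -/
def balancingSequence {n : ℕ} [NeZero n] (ψ : FockVector n) : ℕ → FockVector n
  | 0 => ψ
  | k + 1 => (balancingOperator (balancingSequence ψ k) (stepMode n k)).act
      (balancingSequence ψ k)

end

/-! For a fermionic state, parity kills the off-diagonal entries of the reduced states, so
criticality means that the weights `‖φ x‖ ^ 2` are balanced. A diagonal operator of determinant one
preserves every monomial `∏ x, ‖ψ x‖ ^ q x` with balanced exponents, and for `q ≥ 0` the monomial is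
continuous, so it survives in limits, even at vanishing coefficients.

Uniqueness: if `χ` and `φ` are balanced limits of one orbit, the exponents `‖χ x‖ ^ 2` and `‖φ x‖ ^
2` together give `∑ x, (‖χ x‖ ^ 2 - ‖φ x‖ ^ 2) * (log ‖χ x‖ - log ‖φ x‖) = 0`. All terms are
nonnegative, so the moduli agree (`norm_eq_of_tendsto_act`). Compactness of the torus turns this
into a local unitary (`exists_unitary_of_tendsto_act`), and the same monomials control scalar
factors (`exists_detOne_tendsto`).

Convergence: a step lowers the squared norm by at least the squared displacement of each coefficient
(`norm_sub_sq_balancingOperator_act_le`). Hence displacements tend to zero and all cluster points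
are balanced (`isBalanced_of_subseq_tendsto`). They share their moduli by uniqueness and their
phases because every step multiplies coefficients by positive numbers, so there is only one. -/

/-- The weight of the Fock states of `ψ` in which mode `i` has occupation `s`. -/
noncomputable def modeMass {n : ℕ} (ψ : FockVector n) (i : Fin n) (s : Fin 2) : ℝ :=
  ∑ x with x i = s, ‖ψ x‖ ^ 2

/-- In each mode, the two occupations have the same total weight. -/
def IsBalanced {n : ℕ} (q : (Fin n → Fin 2) → ℝ) : Prop :=
  ∀ i, ∑ x with x i = 0, q x = ∑ x with x i = 1, q x

/-! ### Reduced states, parity and occupation weights -/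

section

variable {n : ℕ}

lemma reorderSign_mul_self (A : Finset (Fin n)) (x : Fin n → Fin 2) :
    reorderSign A x * reorderSign A x = 1 := by
  unfold reorderSign
  simp only [← Finset.prod_mul_distrib, ← mul_pow]
  simp

lemma norm_reorderSign (A : Finset (Fin n)) (x : Fin n → Fin 2) : ‖reorderSign A x‖ = 1 := by
  simp [reorderSign]

lemma reducedState_diag (ψ : FockVector n) (i : Fin n) (s : Fin 2) :
    reducedState ψ i s s = (modeMass ψ i s : ℂ) := by
  unfold reducedState modeMass
  push_cast
  refine Finset.sum_bij' (fun x _ => Function.update x i s) (fun x _ => Function.update x i 0)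
    ?_ ?_ ?_ ?_ ?_
  · simp
  · simp
  · intro x hx
    simp only [Finset.mem_filter, Finset.mem_univ, true_and] at hx
    simp [← hx]
  · intro x hx
    simp only [Finset.mem_filter, Finset.mem_univ, true_and] at hx
    simp [← hx]
  · intro x _
    rw [Complex.mul_conj, Complex.normSq_eq_norm_sq, norm_mul, norm_reorderSign, one_mul]
    push_cast
    rfl

lemma IsCritical.isBalanced {ψ : FockVector n} (h : IsCritical ψ) :
    IsBalanced (fun x => ‖ψ x‖ ^ 2) := by
  intro i
  obtain ⟨c, hc⟩ := h i
  have h0 := reducedState_diag ψ i 0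
  have h1 := reducedState_diag ψ i 1
  rw [hc] at h0 h1
  simp only [Matrix.smul_apply, Matrix.one_apply_eq] at h0 h1
  have := h0.symm.trans h1
  exact_mod_cast this

lemma sum_occupation_update (x : Fin n → Fin 2) (i : Fin n) (s : Fin 2) :
    ∑ j, ((Function.update x i s j : Fin 2) : ℕ)
      = (s : ℕ) + ∑ j ∈ Finset.univ.erase i, (x j : ℕ) := by
  rw [← Finset.add_sum_erase _ _ (Finset.mem_univ i), Function.update_self]
  congr 1
  refine Finset.sum_congr rfl fun j hj => ?_
  rw [Function.update_of_ne (Finset.ne_of_mem_erase hj)]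

/-- Changing the occupation of one mode flips the parity, so in each summand one of the two
coefficients vanishes. -/
lemma IsFermionicState.reducedState_offDiag {ψ : FockVector n} (h : IsFermionicState ψ)
    (i : Fin n) {s t : Fin 2} (hst : s ≠ t) : reducedState ψ i s t = 0 := by
  obtain ⟨-, p, hp⟩ := h
  refine Finset.sum_eq_zero fun x _ => ?_
  by_contra hne
  have hs : ψ (Function.update x i s) ≠ 0 := fun h => hne (by simp [h])
  have ht : ψ (Function.update x i t) ≠ 0 := fun h => hne (by simp [h])
  have e := (hp _ hs).trans (hp _ ht).symm
  rw [sum_occupation_update, sum_occupation_update, Nat.cast_add, Nat.cast_add,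
    add_left_inj] at e
  revert e
  fin_cases s <;> fin_cases t <;> simp_all

lemma IsFermionicState.isCritical {ψ : FockVector n} (h : IsFermionicState ψ)
    (hb : IsBalanced (fun x => ‖ψ x‖ ^ 2)) : IsCritical ψ := by
  intro i
  refine ⟨(modeMass ψ i 0 : ℂ), ?_⟩
  have hi : modeMass ψ i 0 = modeMass ψ i 1 := hb i
  ext s t
  by_cases hst : s = t
  · subst hst
    rw [reducedState_diag]
    fin_cases s <;> simp [hi]
  · simp [h.reducedState_offDiag i hst, hst]

/-- Otherwise mode `i` has a definite occupation and splits off. This is all that the theorem needs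
from full entanglement: it keeps the weights positive and the steps well defined. -/
lemma FullyEntangled.exists_occupation {ψ : FockVector n} (hn : 2 ≤ n) (h : FullyEntangled ψ)
    (i : Fin n) (s : Fin 2) : ∃ x, x i = s ∧ ψ x ≠ 0 := by
  by_contra! hcon
  obtain ⟨t, ht⟩ : ∃ t : Fin 2, ∀ r, r ≠ s → r = t := by
    refine ⟨1 - s, fun r hr => ?_⟩
    clear hcon
    revert r s
    decide
  have hne : ({i}ᶜ : Finset (Fin n)).Nonempty := by
    rw [← Finset.card_pos, Finset.card_compl, Finset.card_singleton, Fintype.card_fin]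
    omega
  let ext : ({j // j ∈ ({i}ᶜ : Finset (Fin n))} → Fin 2) → Fin n → Fin 2 := fun y j =>
    if hj : j ∈ ({i}ᶜ : Finset (Fin n)) then y ⟨j, hj⟩ else t
  -- On the support mode `i` carries `t`, so the reordering sign depends only on the other modes and
  -- can be absorbed into their factor.
  refine h {i} (Finset.singleton_nonempty i) hne
    ⟨fun z => if z ⟨i, Finset.mem_singleton_self i⟩ = s then 0 else 1,
      fun y => reorderSign {i} (ext y) * ψ (ext y), fun x => ?_⟩
  by_cases hx : x i = s
  · simp [hx, hcon x hx]
  · have hxe : ext (fun j => x j) = x := by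
      funext j
      by_cases hj : j = i
      · subst hj
        simp [ext, ht _ hx]
      · simp [ext, hj]
    simp only [hxe, if_neg hx, one_mul]
    rw [← mul_assoc, reorderSign_mul_self, one_mul]

/-! ### Determinant-one operators and their invariant monomials -/

namespace LocalDiagonal

lemma IsDetOne.isInvertible {d : LocalDiagonal n} (h : d.IsDetOne) : d.IsInvertible := by
  intro i s
  have := h i
  fin_cases s
  · exact left_ne_zero_of_mul_eq_one this
  · exact right_ne_zero_of_mul_eq_one this

lemma IsInvertible.prod_ne_zero {d : LocalDiagonal n} (h : d.IsInvertible)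
    (x : Fin n → Fin 2) : ∏ i, d i (x i) ≠ 0 :=
  Finset.prod_ne_zero_iff.2 fun i _ => h i _

lemma mul_act (d e : LocalDiagonal n) (ψ : FockVector n) :
    (d * e).act ψ = d.act (e.act ψ) := by
  funext x
  simp [act, Finset.prod_mul_distrib, mul_assoc]

lemma IsDetOne.mul {d e : LocalDiagonal n} (hd : d.IsDetOne) (he : e.IsDetOne) :
    (d * e).IsDetOne := by
  intro i
  have h1 := hd i
  have h2 := he i
  simp only [Pi.mul_apply]
  linear_combination (e i 0 * e i 1) * h1 + h2

/-- A local diagonal operator of determinant one does not change a monomial in the coefficients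
whose exponents are balanced. -/
lemma IsDetOne.prod_norm_act_rpow {d : LocalDiagonal n} (hd : d.IsDetOne)
    {q : (Fin n → Fin 2) → ℝ} (hq : IsBalanced q) (ψ : FockVector n) :
    ∏ x, ‖d.act ψ x‖ ^ q x = ∏ x, ‖ψ x‖ ^ q x := by
  have hinv := hd.isInvertible
  have key : ∏ x : Fin n → Fin 2, ‖∏ i, d i (x i)‖ ^ q x = 1 := by
    have hpos : ∀ x : Fin n → Fin 2, 0 < ‖∏ i, d i (x i)‖ :=
      fun x => norm_pos_iff.2 (hinv.prod_ne_zero x)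
    refine Real.eq_one_of_pos_of_log_eq_zero
      (Finset.prod_pos fun x _ => Real.rpow_pos_of_pos (hpos x) _) ?_
    rw [Real.log_prod fun x _ => (Real.rpow_pos_of_pos (hpos x) _).ne']
    have e : ∀ x : Fin n → Fin 2, Real.log (‖∏ i, d i (x i)‖ ^ q x)
        = ∑ i, q x * Real.log ‖d i (x i)‖ := by
      intro x
      rw [Real.log_rpow (hpos x), norm_prod,
        Real.log_prod fun i _ => (norm_pos_iff.2 (hinv i _)).ne', Finset.mul_sum]
    rw [Finset.sum_congr rfl fun x _ => e x, Finset.sum_comm]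
    refine Finset.sum_eq_zero fun i _ => ?_
    -- Determinant one makes the two logarithms opposite; balance of `q` then cancels the
    -- contribution of mode `i`.
    have h1 : Real.log ‖d i 1‖ = - Real.log ‖d i 0‖ := by
      have := congrArg (fun z => Real.log ‖z‖) (hd i)
      simp only [norm_mul, norm_one, Real.log_one] at this
      rw [Real.log_mul (norm_pos_iff.2 (hinv i 0)).ne' (norm_pos_iff.2 (hinv i 1)).ne'] at this
      linarith
    rw [← Finset.sum_filter_add_sum_filter_not _ (fun x : Fin n → Fin 2 => x i = 0)]
    have hs : (Finset.univ.filter fun x : Fin n → Fin 2 => ¬ x i = 0)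
        = Finset.univ.filter fun x => x i = 1 := by
      ext x
      simp only [Finset.mem_filter, Finset.mem_univ, true_and]
      omega
    rw [hs]
    have e0 : ∑ x with x i = 0, q x * Real.log ‖d i (x i)‖
        = (∑ x with x i = 0, q x) * Real.log ‖d i 0‖ := by
      rw [Finset.sum_mul]
      refine Finset.sum_congr rfl fun x hx => ?_
      rw [(Finset.mem_filter.1 hx).2]
    have e1 : ∑ x with x i = 1, q x * Real.log ‖d i (x i)‖
        = (∑ x with x i = 1, q x) * Real.log ‖d i 1‖ := by
      rw [Finset.sum_mul]
      refine Finset.sum_congr rfl fun x hx => ?_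
      rw [(Finset.mem_filter.1 hx).2]
    rw [e0, e1, h1, hq i]
    ring
  simp only [act, norm_mul, Real.mul_rpow (norm_nonneg _) (norm_nonneg _),
    Finset.prod_mul_distrib]
  rw [key, one_mul]

end LocalDiagonal

/-! ### Uniqueness of balanced limits -/

lemma prod_rpow_pos_of_support {a q : (Fin n → Fin 2) → ℝ} (ha : ∀ x, 0 ≤ a x)
    (h : ∀ x, q x ≠ 0 → a x ≠ 0) : 0 < ∏ x, a x ^ q x := by
  refine Finset.prod_pos fun x _ => ?_
  by_cases hx : q x = 0
  · simp [hx]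
  · exact Real.rpow_pos_of_pos ((ha x).lt_of_ne' (h x hx)) _

lemma log_prod_rpow_of_support {a q : (Fin n → Fin 2) → ℝ} (ha : ∀ x, 0 ≤ a x)
    (h : ∀ x, q x ≠ 0 → a x ≠ 0) :
    Real.log (∏ x, a x ^ q x) = ∑ x, q x * Real.log (a x) := by
  rw [Real.log_prod]
  · refine Finset.sum_congr rfl fun x _ => ?_
    by_cases hx : q x = 0
    · simp [hx]
    · exact Real.log_rpow ((ha x).lt_of_ne' (h x hx)) _
  · intro x _
    by_cases hx : q x = 0
    · simp [hx]
    · exact (Real.rpow_pos_of_pos ((ha x).lt_of_ne' (h x hx)) _).ne'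

lemma tendsto_prod_norm_rpow {ι : Type*} {l : Filter ι} {v : ι → FockVector n}
    {χ : FockVector n} (hv : Tendsto v l (𝓝 χ)) {q : (Fin n → Fin 2) → ℝ} (hq : ∀ x, 0 ≤ q x) :
    Tendsto (fun k => ∏ x, ‖v k x‖ ^ q x) l (𝓝 (∏ x, ‖χ x‖ ^ q x)) :=
  tendsto_finsetProd _ fun x _ =>
    ((tendsto_pi_nhds.1 hv x).norm).rpow_const (Or.inr (hq x))

lemma support_of_tendsto_act {ι : Type*} {l : Filter ι} [l.NeBot] {ψ χ : FockVector n}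
    {d : ι → LocalDiagonal n} (h : Tendsto (fun k => (d k).act ψ) l (𝓝 χ))
    {x : Fin n → Fin 2} (hx : χ x ≠ 0) : ψ x ≠ 0 := by
  intro h0
  refine hx (tendsto_nhds_unique (tendsto_pi_nhds.1 h x) ?_)
  simp [LocalDiagonal.act, h0]

lemma prod_norm_rpow_of_tendsto {ι : Type*} {l : Filter ι} [l.NeBot] {ψ χ : FockVector n}
    {d : ι → LocalDiagonal n} (hd : ∀ k, (d k).IsDetOne)
    (h : Tendsto (fun k => (d k).act ψ) l (𝓝 χ)) {q : (Fin n → Fin 2) → ℝ}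
    (hq : ∀ x, 0 ≤ q x) (hb : IsBalanced q) :
    ∏ x, ‖χ x‖ ^ q x = ∏ x, ‖ψ x‖ ^ q x := by
  refine tendsto_nhds_unique (tendsto_prod_norm_rpow h hq) ?_
  simp only [(hd _).prod_norm_act_rpow hb]
  exact tendsto_const_nhds

lemma support_of_prod_rpow_pos {a q : (Fin n → Fin 2) → ℝ} (h : 0 < ∏ x, a x ^ q x)
    {x : Fin n → Fin 2} (hx : q x ≠ 0) : a x ≠ 0 := by
  intro h0
  refine h.ne' (Finset.prod_eq_zero (Finset.mem_univ x) ?_)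
  rw [h0, Real.zero_rpow hx]

/-- Two balanced limits of orbits under local diagonal operators of determinant one have
coefficients of the same moduli. -/
lemma norm_eq_of_tendsto_act {ι κ : Type*} {l : Filter ι} {m : Filter κ} [l.NeBot] [m.NeBot]
    {ψ χ φ : FockVector n} {d : ι → LocalDiagonal n} {e : κ → LocalDiagonal n}
    (hd : ∀ k, (d k).IsDetOne) (he : ∀ k, (e k).IsDetOne)
    (hχ : Tendsto (fun k => (d k).act ψ) l (𝓝 χ))
    (hφ : Tendsto (fun k => (e k).act ψ) m (𝓝 φ))
    (bχ : IsBalanced (fun x => ‖χ x‖ ^ 2)) (bφ : IsBalanced (fun x => ‖φ x‖ ^ 2))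
    (x : Fin n → Fin 2) : ‖χ x‖ = ‖φ x‖ := by
  have sχ : ∀ x, ‖χ x‖ ^ 2 ≠ 0 → ‖ψ x‖ ≠ 0 := fun x hx =>
    norm_ne_zero_iff.2 (support_of_tendsto_act hχ (by simpa using hx))
  have sφ : ∀ x, ‖φ x‖ ^ 2 ≠ 0 → ‖ψ x‖ ≠ 0 := fun x hx =>
    norm_ne_zero_iff.2 (support_of_tendsto_act hφ (by simpa using hx))
  have pχ := prod_rpow_pos_of_support (fun x => norm_nonneg (ψ x)) sχ
  have pφ := prod_rpow_pos_of_support (fun x => norm_nonneg (ψ x)) sφ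
  have nn : ∀ (η : FockVector n) (x), 0 ≤ ‖η x‖ ^ 2 := fun _ _ => by positivity
  have e1 := prod_norm_rpow_of_tendsto hd hχ (nn χ) bχ
  have e2 := prod_norm_rpow_of_tendsto hd hχ (nn φ) bφ
  have e3 := prod_norm_rpow_of_tendsto he hφ (nn χ) bχ
  have e4 := prod_norm_rpow_of_tendsto he hφ (nn φ) bφ
  -- A positive monomial excludes zeros on the support of its exponents. The mixed cases `s2` and
  -- `s3` show that `χ` and `φ` have the same support.
  have s1 := fun x => support_of_prod_rpow_pos (e1 ▸ pχ) (x := x)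
  have s2 := fun x => support_of_prod_rpow_pos (e2 ▸ pφ) (x := x)
  have s3 := fun x => support_of_prod_rpow_pos (e3 ▸ pχ) (x := x)
  have s4 := fun x => support_of_prod_rpow_pos (e4 ▸ pφ) (x := x)
  have l1 := log_prod_rpow_of_support (fun x => norm_nonneg (χ x)) s1
  have l2 := log_prod_rpow_of_support (fun x => norm_nonneg (χ x)) s2
  have l3 := log_prod_rpow_of_support (fun x => norm_nonneg (φ x)) s3
  have l4 := log_prod_rpow_of_support (fun x => norm_nonneg (φ x)) s4
  rw [e1, ← e3, l3] at l1
  rw [e2, ← e4, l4] at l2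
  have hsum : ∑ x, (‖χ x‖ ^ 2 - ‖φ x‖ ^ 2) * (Real.log ‖χ x‖ - Real.log ‖φ x‖) = 0 := by
    have : ∀ x, (‖χ x‖ ^ 2 - ‖φ x‖ ^ 2) * (Real.log ‖χ x‖ - Real.log ‖φ x‖)
        = (‖χ x‖ ^ 2 * Real.log ‖χ x‖ - ‖χ x‖ ^ 2 * Real.log ‖φ x‖)
          - (‖φ x‖ ^ 2 * Real.log ‖χ x‖ - ‖φ x‖ ^ 2 * Real.log ‖φ x‖) := fun x => by ring
    simp only [this, Finset.sum_sub_distrib]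
    linarith
  have hs : χ x = 0 ↔ φ x = 0 := by
    constructor
    · intro h
      by_contra hne
      exact s2 x (by simpa using hne) (by simpa using h)
    · intro h
      by_contra hne
      exact s3 x (by simpa using hne) (by simpa using h)
  have hterm : ∀ y, 0 ≤ (‖χ y‖ ^ 2 - ‖φ y‖ ^ 2) * (Real.log ‖χ y‖ - Real.log ‖φ y‖) := by
    intro y
    by_cases h1 : χ y = 0
    · by_cases h2 : φ y = 0
      · simp [h1, h2]
      · exact absurd (by simpa using h1) (s2 y (by simpa using h2))
    by_cases h2 : φ y = 0
    · exact absurd (by simpa using h2) (s3 y (by simpa using h1))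
    rcases le_total ‖χ y‖ ‖φ y‖ with hle | hle
    · refine mul_nonneg_of_nonpos_of_nonpos ?_ ?_
      · exact sub_nonpos.2 (by gcongr)
      · exact sub_nonpos.2 (Real.log_le_log (norm_pos_iff.2 h1) hle)
    · refine mul_nonneg ?_ ?_
      · exact sub_nonneg.2 (by gcongr)
      · exact sub_nonneg.2 (Real.log_le_log (norm_pos_iff.2 h2) hle)
  have hx := (Finset.sum_eq_zero_iff_of_nonneg fun y _ => hterm y).1 hsum x (Finset.mem_univ x)
  by_cases h1 : χ x = 0
  · rw [h1, hs.1 h1]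
  have h2 : φ x ≠ 0 := fun h => h1 (hs.2 h)
  rcases mul_eq_zero.1 hx with h | h
  · exact (sq_eq_sq₀ (norm_nonneg _) (norm_nonneg _)).1 (sub_eq_zero.1 h)
  · exact Real.log_injOn_pos (norm_pos_iff.2 h1) (norm_pos_iff.2 h2) (sub_eq_zero.1 h)

/-- A limit of vectors `d k • ψ` whose coefficients have the moduli of those of a vector `φ` with
the phases of `ψ` differs from `φ` by a local unitary. -/
lemma exists_unitary_of_tendsto_act {ψ χ φ : FockVector n} {d : ℕ → LocalDiagonal n}
    (hd : ∀ k, (d k).IsInvertible) (hχ : Tendsto (fun k => (d k).act ψ) atTop (𝓝 χ))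
    (hnorm : ∀ x, ‖χ x‖ = ‖φ x‖) {r : (Fin n → Fin 2) → ℝ} (hr : ∀ x, 0 ≤ r x)
    (hφ : ∀ x, φ x = r x * ψ x) :
    ∃ u : LocalDiagonal n, u.IsUnitary ∧ χ = u.act φ := by
  -- The phases of the operators live in a compact torus, so along a subsequence they converge to
  -- the required unitary; the moduli need not converge.
  let v : ℕ → LocalDiagonal n := fun k i s => d k i s / ‖d k i s‖
  have hc : IsCompact (Set.univ.pi fun _ : Fin n => Set.univ.pi fun _ : Fin 2 =>
      Metric.sphere (0 : ℂ) 1) :=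
    isCompact_univ_pi fun _ => isCompact_univ_pi fun _ => isCompact_sphere _ _
  obtain ⟨u, hu, a, ha, hlim⟩ := hc.tendsto_subseq (x := v) (fun k i _ s _ => by
    have : ‖d k i s‖ ≠ 0 := norm_ne_zero_iff.2 (hd k i s)
    simp [v, this])
  refine ⟨u, fun i s => by simpa using hu i trivial s trivial, ?_⟩
  funext x
  have hχx := (tendsto_pi_nhds.1 hχ x).comp ha.tendsto_atTop
  refine tendsto_nhds_unique hχx ?_
  have h1 : Tendsto (fun k => ∏ i, v (a k) i (x i)) atTop (𝓝 (∏ i, u i (x i))) :=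
    tendsto_finsetProd _ fun i _ => tendsto_pi_nhds.1 (tendsto_pi_nhds.1 hlim i) (x i)
  have h2 : Tendsto (fun k => ((‖∏ i, d (a k) i (x i)‖ : ℝ) : ℂ) * ψ x) atTop (𝓝 (φ x)) := by
    by_cases h0 : ψ x = 0
    · simp [hφ, h0]
    have hp : ‖ψ x‖ ≠ 0 := norm_ne_zero_iff.2 h0
    have h3 := hχx.norm
    rw [hnorm x, hφ x, norm_mul, Complex.norm_real, Real.norm_of_nonneg (hr x)] at h3
    have h4 := h3.mul_const ‖ψ x‖⁻¹
    rw [mul_assoc, mul_inv_cancel₀ hp, mul_one] at h4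
    rw [hφ x]
    refine (((Complex.continuous_ofReal.tendsto _).comp h4).mul_const (ψ x)).congr fun k => ?_
    simp only [Function.comp_apply, LocalDiagonal.act, norm_mul]
    rw [mul_assoc, mul_inv_cancel₀ hp, mul_one]
  refine (h1.mul h2).congr fun k => ?_
  simp only [Function.comp_apply, LocalDiagonal.act, v, Finset.prod_div_distrib, norm_prod,
    Complex.ofReal_prod]
  have : ∏ i, ((‖d (a k) i (x i)‖ : ℝ) : ℂ) ≠ 0 :=
    Finset.prod_ne_zero_iff.2 fun i _ => by simpa using hd (a k) i (x i)
  field_simp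

/-- Each factor is divided by a square root of its determinant. -/
lemma exists_scalar_detOne {d : LocalDiagonal n} (hd : d.IsInvertible) :
    ∃ (c : ℂ) (e : LocalDiagonal n), c ≠ 0 ∧ e.IsDetOne ∧
      ∀ ψ : FockVector n, d.act ψ = c • e.act ψ := by
  have : ∀ i, ∃ c : ℂ, c ^ 2 = d i 0 * d i 1 := fun i =>
    IsAlgClosed.exists_pow_nat_eq _ two_pos
  choose c hc using this
  have hc0 : ∀ i, c i ≠ 0 := fun i h => by
    have := hc i
    rw [h, zero_pow two_ne_zero] at this
    exact mul_ne_zero (hd i 0) (hd i 1) this.symm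
  refine ⟨∏ i, c i, fun i s => d i s / c i, Finset.prod_ne_zero_iff.2 fun i _ => hc0 i,
    fun i => ?_, fun ψ => ?_⟩
  · have := hc0 i
    rw [div_mul_div_comm, ← hc i]
    field_simp
  · funext x
    have : ∏ i, c i ≠ 0 := Finset.prod_ne_zero_iff.2 fun i _ => hc0 i
    simp only [LocalDiagonal.act, Pi.smul_apply, smul_eq_mul, Finset.prod_div_distrib]
    field_simp

/-- A nonzero balanced limit under invertible local diagonal operators is, up to a scalar, a limit
under operators of determinant one. -/
lemma exists_detOne_tendsto {ψ χ : FockVector n} {d : ℕ → LocalDiagonal n}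
    (hd : ∀ k, (d k).IsInvertible) (hχ : Tendsto (fun k => (d k).act ψ) atTop (𝓝 χ))
    (h0 : χ ≠ 0) (hb : IsBalanced (fun x => ‖χ x‖ ^ 2)) :
    ∃ (c : ℂ) (e : ℕ → LocalDiagonal n), c ≠ 0 ∧ (∀ k, (e k).IsDetOne) ∧
      Tendsto (fun k => (e k).act ψ) atTop (𝓝 (c⁻¹ • χ)) := by
  choose c e hc he hde using fun k => exists_scalar_detOne (hd k)
  have nn : ∀ x, 0 ≤ ‖χ x‖ ^ 2 := fun x => by positivity
  have hlim := tendsto_prod_norm_rpow hχ nn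
  set Q : ℝ := ∑ x, ‖χ x‖ ^ 2 with hQ
  have hQpos : 0 < Q := by
    obtain ⟨x, hx⟩ := Function.ne_iff.1 h0
    refine Finset.sum_pos' (fun x _ => nn x) ⟨x, Finset.mem_univ x, ?_⟩
    have : 0 < ‖χ x‖ := norm_pos_iff.2 hx
    positivity
  set P : ℝ := ∏ x, ‖ψ x‖ ^ (‖χ x‖ ^ 2) with hP
  have hPpos : 0 < P := prod_rpow_pos_of_support (fun x => norm_nonneg _) fun x hx =>
    norm_ne_zero_iff.2 (support_of_tendsto_act hχ (by simpa using hx))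
  set L : ℝ := ∏ x, ‖χ x‖ ^ (‖χ x‖ ^ 2) with hL
  have hLpos : 0 < L := prod_rpow_pos_of_support (fun x => norm_nonneg _) fun x hx => by
    simpa using hx
  -- The monomial is homogeneous of degree `Q` and blind to `e k`, so it determines `‖c k‖`, which
  -- therefore converges to a positive number.
  have hcQ : ∀ k, ∏ x, ‖(d k).act ψ x‖ ^ (‖χ x‖ ^ 2) = ‖c k‖ ^ Q * P := by
    intro k
    rw [hde k ψ]
    simp only [Pi.smul_apply, smul_eq_mul, norm_mul,
      Real.mul_rpow (norm_nonneg _) (norm_nonneg _), Finset.prod_mul_distrib]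
    rw [(he k).prod_norm_act_rpow hb ψ, hQ,
      Real.rpow_sum_of_pos (norm_pos_iff.2 (hc k))]
  simp only [hcQ] at hlim
  have hlim2 : Tendsto (fun k => ‖c k‖) atTop (𝓝 ((L / P) ^ Q⁻¹)) := by
    have := (hlim.div_const P).rpow_const (p := Q⁻¹) (Or.inr (by positivity))
    refine this.congr fun k => ?_
    rw [mul_div_cancel_right₀ _ hPpos.ne', Real.rpow_rpow_inv (norm_nonneg _) hQpos.ne']
  obtain ⟨B, hB⟩ := hlim2.bddAbove_range
  obtain ⟨c₀, -, a, ha, hca⟩ := (isCompact_closedBall (0 : ℂ) B).tendsto_subseq (x := c)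
    (fun k => by simpa using hB ⟨k, rfl⟩)
  have hc₀ : c₀ ≠ 0 := by
    have h1 := tendsto_nhds_unique hca.norm (hlim2.comp ha.tendsto_atTop)
    rw [← norm_pos_iff, h1]
    positivity
  refine ⟨c₀, fun k => e (a k), hc₀, fun k => he _, ?_⟩
  refine ((hca.inv₀ hc₀).smul (hχ.comp ha.tendsto_atTop)).congr fun k => ?_
  simp [hde, smul_smul, hc]

end

/-! ### A single balancing step -/

section

variable {n : ℕ}

lemma sum_norm_sq_eq_modeMass (ψ : FockVector n) (i : Fin n) :
    ∑ x, ‖ψ x‖ ^ 2 = modeMass ψ i 0 + modeMass ψ i 1 := by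
  unfold modeMass
  rw [← Finset.sum_filter_add_sum_filter_not Finset.univ (fun x : Fin n → Fin 2 => x i = 0)]
  congr 1
  refine Finset.sum_congr ?_ fun _ _ => rfl
  ext x
  simp only [Finset.mem_filter, Finset.mem_univ, true_and]
  omega

lemma modeMass_pos {ψ : FockVector n} {i : Fin n} {s : Fin 2} (h : ∃ x, x i = s ∧ ψ x ≠ 0) :
    0 < modeMass ψ i s := by
  obtain ⟨x, hx, h0⟩ := h
  refine Finset.sum_pos' (fun x _ => by positivity) ⟨x, by simpa using hx, ?_⟩
  have : 0 < ‖ψ x‖ := norm_pos_iff.2 h0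
  positivity

/-- The real factor with which the balancing operator of mode `i` acts on occupation `s`. -/
noncomputable def balancingFactor (ψ : FockVector n) (i : Fin n) (s : Fin 2) : ℝ :=
  (modeMass ψ i 0 * modeMass ψ i 1) ^ (1 / 4 : ℝ) / Real.sqrt (modeMass ψ i s)

lemma balancingOperator_eq {ψ : FockVector n} (h : IsFermionicState ψ) (i : Fin n) :
    balancingOperator ψ i
      = Function.update (fun _ _ => 1) i fun s => (balancingFactor ψ i s : ℂ) := by
  unfold balancingOperator balancingFactor
  congr 1
  funext s
  rw [Matrix.det_fin_two, h.reducedState_offDiag i (by decide : (0 : Fin 2) ≠ 1)]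
  simp only [reducedState_diag, zero_mul, sub_zero, ← Complex.ofReal_mul, Complex.ofReal_re]

lemma balancingFactor_pos {ψ : FockVector n} {i : Fin n} (h : ∀ s, 0 < modeMass ψ i s)
    (s : Fin 2) : 0 < balancingFactor ψ i s := by
  have h0 := h 0
  have h1 := h 1
  have hs := h s
  unfold balancingFactor
  positivity

lemma rpow_quarter_sq {a : ℝ} (ha : 0 ≤ a) : (a ^ (1 / 4 : ℝ)) ^ 2 = Real.sqrt a := by
  rw [← Real.rpow_natCast, ← Real.rpow_mul ha, Real.sqrt_eq_rpow]
  norm_num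

lemma balancingFactor_mul {ψ : FockVector n} {i : Fin n} (h : ∀ s, 0 < modeMass ψ i s) :
    balancingFactor ψ i 0 * balancingFactor ψ i 1 = 1 := by
  have h0 := h 0
  have h1 := h 1
  have hp : 0 < modeMass ψ i 0 * modeMass ψ i 1 := mul_pos h0 h1
  unfold balancingFactor
  rw [div_mul_div_comm, ← pow_two, rpow_quarter_sq hp.le, ← Real.sqrt_mul h0.le, div_self]
  positivity

lemma balancingOperator_isDetOne {ψ : FockVector n} (hψ : IsFermionicState ψ) {i : Fin n}
    (h : ∀ s, 0 < modeMass ψ i s) : (balancingOperator ψ i).IsDetOne := by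
  intro j
  rw [balancingOperator_eq hψ]
  by_cases hj : j = i
  · subst hj
    simp only [Function.update_self]
    exact_mod_cast balancingFactor_mul h
  · simp [Function.update_of_ne hj]

lemma balancingOperator_act {ψ : FockVector n} (hψ : IsFermionicState ψ) (i : Fin n)
    (x : Fin n → Fin 2) :
    (balancingOperator ψ i).act ψ x = (balancingFactor ψ i (x i) : ℂ) * ψ x := by
  rw [balancingOperator_eq hψ]
  unfold LocalDiagonal.act
  congr 1
  rw [Finset.prod_eq_single i]
  · simp
  · intro j _ hj
    simp [Function.update_of_ne hj]
  · simp

lemma modeMass_balancingOperator_act {ψ : FockVector n} (hψ : IsFermionicState ψ) {i : Fin n}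
    (h : ∀ s, 0 < modeMass ψ i s) (s : Fin 2) :
    modeMass ((balancingOperator ψ i).act ψ) i s
      = Real.sqrt (modeMass ψ i 0 * modeMass ψ i 1) := by
  have h0 := h 0
  have h1 := h 1
  have hs := h s
  have e : modeMass ((balancingOperator ψ i).act ψ) i s
      = balancingFactor ψ i s ^ 2 * modeMass ψ i s := by
    unfold modeMass
    rw [Finset.mul_sum]
    refine Finset.sum_congr rfl fun x hx => ?_
    rw [balancingOperator_act hψ, (Finset.mem_filter.1 hx).2, norm_mul, Complex.norm_real,
      mul_pow, Real.norm_eq_abs, sq_abs]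
  rw [e, balancingFactor, div_pow, rpow_quarter_sq (by positivity), Real.sq_sqrt hs.le,
    div_mul_cancel₀ _ hs.ne']

/-- With `α`, `β` the square roots of the two weights and `g` their geometric mean, the squared norm
drops by `(α - β) ^ 2`, while the part with weight `α ^ 2` moves by `|g - α|`, and `g` lies between
`α` and `β`. -/
lemma norm_sub_sq_balancingOperator_act_le {ψ : FockVector n} (hψ : IsFermionicState ψ)
    {i : Fin n} (h : ∀ s, 0 < modeMass ψ i s) (x : Fin n → Fin 2) :
    ‖(balancingOperator ψ i).act ψ x - ψ x‖ ^ 2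
      ≤ ∑ y, ‖ψ y‖ ^ 2 - ∑ y, ‖(balancingOperator ψ i).act ψ y‖ ^ 2 := by
  have h0 := h 0
  have h1 := h 1
  have hs := h (x i)
  rw [sum_norm_sq_eq_modeMass _ i, sum_norm_sq_eq_modeMass ((balancingOperator ψ i).act ψ) i,
    modeMass_balancingOperator_act hψ h, modeMass_balancingOperator_act hψ h]
  have hx : ‖ψ x‖ ^ 2 ≤ modeMass ψ i (x i) :=
    Finset.single_le_sum (f := fun y => ‖ψ y‖ ^ 2) (fun y _ => by positivity)
      (by simp : x ∈ Finset.univ.filter fun y : Fin n → Fin 2 => y i = x i)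
  have e : (balancingOperator ψ i).act ψ x - ψ x
      = ((balancingFactor ψ i (x i) - 1 : ℝ) : ℂ) * ψ x := by
    rw [balancingOperator_act hψ]
    push_cast
    ring
  rw [e, norm_mul, Complex.norm_real, mul_pow, Real.norm_eq_abs, sq_abs]
  refine (mul_le_mul_of_nonneg_left hx (sq_nonneg _)).trans ?_
  set a := modeMass ψ i 0
  set b := modeMass ψ i 1
  set g := (a * b) ^ (1 / 4 : ℝ) with hg
  have hgpos : 0 ≤ g := by positivity
  have hg2 : g ^ 2 = Real.sqrt a * Real.sqrt b := by
    rw [hg, rpow_quarter_sq (by positivity), Real.sqrt_mul h0.le]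
  have e2 : (balancingFactor ψ i (x i) - 1) ^ 2 * modeMass ψ i (x i)
      = (g - Real.sqrt (modeMass ψ i (x i))) ^ 2 := by
    have hq : Real.sqrt (modeMass ψ i (x i)) ≠ 0 := by positivity
    conv_lhs => rw [← Real.sq_sqrt hs.le]
    rw [← mul_pow, balancingFactor, sub_mul, div_mul_cancel₀ _ hq, one_mul]
  have e3 : a + b - (Real.sqrt (a * b) + Real.sqrt (a * b))
      = (Real.sqrt a - Real.sqrt b) ^ 2 := by
    rw [Real.sqrt_mul h0.le]
    nlinarith [Real.sq_sqrt h0.le, Real.sq_sqrt h1.le]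
  rw [e2, e3]
  have key : ∀ α β : ℝ, 0 ≤ α → 0 ≤ β → g ^ 2 = α * β → (g - α) ^ 2 ≤ (α - β) ^ 2 := by
    intro α β hα hβ hgab
    refine sq_le_sq.2 ?_
    rcases le_total α β with hab | hab
    · have h1 : α ≤ g := by nlinarith
      have h2 : g ≤ β := by nlinarith
      rw [abs_of_nonneg (by linarith), abs_of_nonpos (by linarith)]
      linarith
    · have h1 : g ≤ α := by nlinarith
      have h2 : β ≤ g := by nlinarith
      rw [abs_of_nonpos (by linarith), abs_of_nonneg (by linarith)]
      linarith
  have hx2 : ∀ s : Fin 2, s = 0 ∨ s = 1 := by decide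
  rcases hx2 (x i) with hxi | hxi <;> rw [hxi]
  · exact key _ _ (Real.sqrt_nonneg _) (Real.sqrt_nonneg _) hg2
  · rw [← neg_sq (Real.sqrt a - Real.sqrt b), neg_sub]
    exact key _ _ (Real.sqrt_nonneg _) (Real.sqrt_nonneg _) (by rw [hg2, mul_comm])

lemma continuous_modeMass (i : Fin n) (s : Fin 2) :
    Continuous fun ψ : FockVector n => modeMass ψ i s := by
  unfold modeMass
  fun_prop

lemma IsFermionicState.of_support {ψ φ : FockVector n} (h : IsFermionicState ψ) (h0 : φ ≠ 0)
    (hs : ∀ x, φ x ≠ 0 → ψ x ≠ 0) : IsFermionicState φ :=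
  ⟨h0, h.2.imp fun _ hp x hx => hp x (hs x hx)⟩

lemma IsFermionicState.act {ψ : FockVector n} (h : IsFermionicState ψ) {d : LocalDiagonal n}
    (hd : d.IsInvertible) : IsFermionicState (d.act ψ) := by
  refine h.of_support (fun h0 => h.1 ?_) fun x hx => right_ne_zero_of_mul hx
  funext x
  exact (mul_eq_zero.1 (congrFun h0 x)).resolve_left (hd.prod_ne_zero x)

/-! ### Convergence of the balancing sequence -/

variable [NeZero n]

/-- Each vector of the balancing sequence is the image of the initial one under a local diagonal
operator of determinant one, whose action on the coefficients is by positive numbers. -/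
lemma exists_detOne_balancingSequence {ψ : FockVector n} (hψ : IsFermionicState ψ)
    (hocc : ∀ i s, ∃ x, x i = s ∧ ψ x ≠ 0) (k : ℕ) :
    ∃ (d : LocalDiagonal n) (r : (Fin n → Fin 2) → ℝ), d.IsDetOne ∧
      balancingSequence ψ k = d.act ψ ∧ (∀ x, 0 < r x) ∧
      ∀ x, balancingSequence ψ k x = r x * ψ x := by
  induction k with
  | zero =>
    refine ⟨fun _ _ => 1, fun _ => 1, fun i => by simp, ?_, fun _ => one_pos, fun x => ?_⟩
    · funext x
      simp [balancingSequence, LocalDiagonal.act]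
    · simp [balancingSequence]
  | succ k ih =>
    obtain ⟨d, r, hd, hk, hr, hkr⟩ := ih
    have hf : IsFermionicState (balancingSequence ψ k) := hk ▸ hψ.act hd.isInvertible
    have hm : ∀ s, 0 < modeMass (balancingSequence ψ k) (stepMode n k) s := fun s => by
      obtain ⟨x, hx, h0⟩ := hocc (stepMode n k) s
      refine modeMass_pos ⟨x, hx, ?_⟩
      rw [hkr]
      exact mul_ne_zero (by exact_mod_cast (hr x).ne') h0
    refine ⟨balancingOperator (balancingSequence ψ k) (stepMode n k) * d,
      fun x => balancingFactor (balancingSequence ψ k) (stepMode n k) (x (stepMode n k)) * r x,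
      (balancingOperator_isDetOne hf hm).mul hd, ?_,
      fun x => mul_pos (balancingFactor_pos hm _) (hr x), fun x => ?_⟩
    · rw [LocalDiagonal.mul_act, ← hk]
      rfl
    · rw [balancingSequence, balancingOperator_act hf, hkr]
      push_cast
      ring

lemma isFermionicState_balancingSequence {ψ : FockVector n} (hψ : IsFermionicState ψ)
    (hocc : ∀ i s, ∃ x, x i = s ∧ ψ x ≠ 0) (k : ℕ) :
    IsFermionicState (balancingSequence ψ k) := by
  obtain ⟨d, -, hd, hk, -⟩ := exists_detOne_balancingSequence hψ hocc k
  exact hk ▸ hψ.act hd.isInvertible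

lemma modeMass_balancingSequence_pos {ψ : FockVector n} (hψ : IsFermionicState ψ)
    (hocc : ∀ i s, ∃ x, x i = s ∧ ψ x ≠ 0) (k : ℕ) (i : Fin n) (s : Fin 2) :
    0 < modeMass (balancingSequence ψ k) i s := by
  obtain ⟨-, r, -, -, hr, hkr⟩ := exists_detOne_balancingSequence hψ hocc k
  obtain ⟨x, hx, h0⟩ := hocc i s
  refine modeMass_pos ⟨x, hx, ?_⟩
  rw [hkr]
  exact mul_ne_zero (by exact_mod_cast (hr x).ne') h0

lemma exists_stepMode_eq (k : ℕ) (i : Fin n) : ∃ m < n, stepMode n (k + m) = i := by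
  have hn : 0 < n := Nat.pos_of_ne_zero (NeZero.ne n)
  refine ⟨(i + (n - k % n)) % n, Nat.mod_lt _ hn, ?_⟩
  have hk := Nat.mod_lt k hn
  apply Fin.ext
  simp only [stepMode, Fin.ofNat]
  rw [Nat.add_mod, Nat.mod_mod, ← Nat.add_mod]
  have : k + (i + (n - k % n)) = i + n * (k / n) + n := by
    have := Nat.div_add_mod k n
    omega
  rw [this, Nat.add_mod_right, Nat.add_mul_mod_self_left, Nat.mod_eq_of_lt i.2]

lemma antitone_sum_norm_sq_balancingSequence {ψ : FockVector n} (hψ : IsFermionicState ψ)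
    (hocc : ∀ i s, ∃ x, x i = s ∧ ψ x ≠ 0) :
    Antitone fun k => ∑ x, ‖balancingSequence ψ k x‖ ^ 2 := by
  refine antitone_nat_of_succ_le fun k => ?_
  -- The index `0` is arbitrary: only the sign of the left side matters.
  have := norm_sub_sq_balancingOperator_act_le (isFermionicState_balancingSequence hψ hocc k)
    (modeMass_balancingSequence_pos hψ hocc k (stepMode n k)) 0
  exact sub_nonneg.1 ((sq_nonneg _).trans this)

lemma tendsto_dist_balancingSequence_succ {ψ : FockVector n} (hψ : IsFermionicState ψ)
    (hocc : ∀ i s, ∃ x, x i = s ∧ ψ x ≠ 0) :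
    Tendsto (fun k => dist (balancingSequence ψ k) (balancingSequence ψ (k + 1))) atTop
      (𝓝 0) := by
  have hlim := tendsto_atTop_ciInf (antitone_sum_norm_sq_balancingSequence hψ hocc)
    ⟨0, by rintro _ ⟨k, rfl⟩; positivity⟩
  have hdiff := hlim.sub (hlim.comp (tendsto_add_atTop_nat 1))
  rw [sub_self] at hdiff
  have hsqrt := hdiff.sqrt
  rw [Real.sqrt_zero] at hsqrt
  refine squeeze_zero (fun _ => dist_nonneg) (fun k => ?_) hsqrt
  rw [dist_comm]
  refine (dist_pi_le_iff (Real.sqrt_nonneg _)).2 fun x => ?_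
  rw [dist_eq_norm]
  exact Real.le_sqrt_of_sq_le
    (norm_sub_sq_balancingOperator_act_le (isFermionicState_balancingSequence hψ hocc k)
      (modeMass_balancingSequence_pos hψ hocc k (stepMode n k)) x)

/-- Within `n` steps of any time, mode `i` is treated and becomes exactly balanced. Since the
displacement over `n` steps tends to zero, these balanced vectors have the same limit. -/
lemma isBalanced_of_subseq_tendsto {ψ φ : FockVector n} (hψ : IsFermionicState ψ)
    (hocc : ∀ i s, ∃ x, x i = s ∧ ψ x ≠ 0) {a : ℕ → ℕ} (ha : Tendsto a atTop atTop)
    (hφ : Tendsto (fun j => balancingSequence ψ (a j)) atTop (𝓝 φ)) :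
    IsBalanced (fun x => ‖φ x‖ ^ 2) := by
  intro i
  choose m hmn hm using fun k => exists_stepMode_eq (n := n) k i
  have hE : Tendsto (fun k => ∑ l ∈ Finset.range n,
      dist (balancingSequence ψ (k + l)) (balancingSequence ψ (k + l + 1))) atTop (𝓝 0) := by
    have := tendsto_finsetSum (Finset.range n) fun l _ =>
      (tendsto_dist_balancingSequence_succ hψ hocc).comp (tendsto_add_atTop_nat l)
    simpa using this
  have hdist : ∀ k, dist (balancingSequence ψ k) (balancingSequence ψ (k + m k + 1))
      ≤ ∑ l ∈ Finset.range n,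
        dist (balancingSequence ψ (k + l)) (balancingSequence ψ (k + l + 1)) := fun k =>
    (dist_le_range_sum_dist (fun l => balancingSequence ψ (k + l)) (m k + 1)).trans
      (Finset.sum_le_sum_of_subset_of_nonneg (Finset.range_mono (hmn k))
        fun _ _ _ => dist_nonneg)
  have hclose := squeeze_zero (fun _ => dist_nonneg) hdist hE
  have hφ' : Tendsto (fun j => balancingSequence ψ (a j + m (a j) + 1)) atTop (𝓝 φ) :=
    (tendsto_iff_of_dist (hclose.comp ha)).1 hφ
  have t0 := ((continuous_modeMass i 0).tendsto φ).comp hφ'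
  have t1 := ((continuous_modeMass i 1).tendsto φ).comp hφ'
  refine tendsto_nhds_unique t0 (t1.congr fun j => ?_)
  set k := a j + m (a j) with hk
  have hmode : stepMode n k = i := hm (a j)
  have h1 := modeMass_balancingOperator_act (isFermionicState_balancingSequence hψ hocc k)
    (modeMass_balancingSequence_pos hψ hocc k (stepMode n k))
  rw [hmode] at h1
  have hk1 : balancingSequence ψ (k + 1)
      = (balancingOperator (balancingSequence ψ k) i).act (balancingSequence ψ k) := by
    rw [balancingSequence, hmode]
  simp only [Function.comp_apply, ← hk, hk1, h1]

/-- The balancing sequence converges to a balanced vector with the phases of the initial one. -/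
lemma exists_tendsto_balancingSequence {ψ : FockVector n} (hψ : IsFermionicState ψ)
    (hocc : ∀ i s, ∃ x, x i = s ∧ ψ x ≠ 0) :
    ∃ (φ : FockVector n) (r : (Fin n → Fin 2) → ℝ),
      Tendsto (balancingSequence ψ) atTop (𝓝 φ) ∧ IsBalanced (fun x => ‖φ x‖ ^ 2) ∧
      (∀ x, 0 ≤ r x) ∧ ∀ x, φ x = r x * ψ x := by
  choose d r hd hdk hr hrk using exists_detOne_balancingSequence hψ hocc
  set R : ℝ := Real.sqrt (∑ x, ‖ψ x‖ ^ 2) with hR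
  have hmem : ∀ k, balancingSequence ψ k ∈ Metric.closedBall (0 : FockVector n) R := by
    intro k
    rw [mem_closedBall_zero_iff]
    refine (pi_norm_le_iff_of_nonneg (Real.sqrt_nonneg _)).2 fun x => Real.le_sqrt_of_sq_le ?_
    refine (Finset.single_le_sum (f := fun x => ‖balancingSequence ψ k x‖ ^ 2)
      (fun x _ => by positivity) (Finset.mem_univ x)).trans ?_
    exact antitone_sum_norm_sq_balancingSequence hψ hocc (Nat.zero_le k)
  have hcpt := isCompact_closedBall (0 : FockVector n) R
  -- A cluster point is determined by its moduli, since its phases are those of `ψ`.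
  have phase : ∀ (a : ℕ → ℕ) (φ : FockVector n),
      Tendsto (fun j => balancingSequence ψ (a j)) atTop (𝓝 φ) →
      ∀ x, φ x = ((‖φ x‖ / ‖ψ x‖ : ℝ) : ℂ) * ψ x := by
    intro a φ hφ x
    have hx := tendsto_pi_nhds.1 hφ x
    by_cases h0 : ψ x = 0
    · rw [h0, mul_zero]
      refine tendsto_nhds_unique hx ?_
      simp [hrk, h0]
    · have hp : ‖ψ x‖ ≠ 0 := norm_ne_zero_iff.2 h0
      refine tendsto_nhds_unique hx ?_
      have h1 := ((Complex.continuous_ofReal.tendsto _).comp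
        (hx.norm.div_const ‖ψ x‖)).mul_const (ψ x)
      refine h1.congr fun j => ?_
      simp only [Function.comp_apply, hrk, norm_mul, Complex.norm_real,
        Real.norm_of_nonneg (hr _ x).le]
      rw [mul_div_cancel_right₀ _ hp]
  obtain ⟨φ, -, a, ha, hlim⟩ := hcpt.tendsto_subseq hmem
  have hlim' : Tendsto (fun j => balancingSequence ψ (a j)) atTop (𝓝 φ) := hlim
  have hbal := isBalanced_of_subseq_tendsto hψ hocc ha.tendsto_atTop hlim'
  refine ⟨φ, fun x => ‖φ x‖ / ‖ψ x‖, ?_, hbal, fun x => by positivity, phase a φ hlim'⟩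
  refine tendsto_of_subseq_tendsto fun b hb => ?_
  obtain ⟨φ', -, c, hc, hlim₂⟩ := hcpt.tendsto_subseq fun j => hmem (b j)
  have hlim₂' : Tendsto (fun j => balancingSequence ψ (b (c j))) atTop (𝓝 φ') := hlim₂
  have hbal' := isBalanced_of_subseq_tendsto hψ hocc (hb.comp hc.tendsto_atTop) hlim₂'
  have hnorm : ∀ x, ‖φ' x‖ = ‖φ x‖ := by
    refine norm_eq_of_tendsto_act (ψ := ψ) (l := atTop) (m := atTop)
      (d := fun j => d (b (c j))) (e := fun j => d (a j))
      (fun _ => hd _) (fun _ => hd _) ?_ ?_ hbal' hbal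
    · simpa only [← hdk] using hlim₂'
    · simpa only [← hdk] using hlim'
  have : φ' = φ := by
    funext x
    rw [phase _ φ' hlim₂' x, hnorm x, ← phase a φ hlim' x]
  exact ⟨c, this ▸ hlim₂'⟩

end

theorem mainTheorem10 (n : ℕ) [NeZero n] (hn : 2 ≤ n) (ψ : FockVector n)
    (hψ : IsFermionicState ψ) (hent : FullyEntangled ψ) :
    ∃ φ : FockVector n,
      -- every step of the explicit iteration applies an invertible local diagonal operator
      (∀ k, (balancingOperator (balancingSequence ψ k) (stepMode n k)).IsDetOne) ∧
      -- the iteration converges to a critical state, or to zero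
      Tendsto (balancingSequence ψ) atTop (𝓝 φ) ∧
      (φ = 0 ∨ (IsFermionicState φ ∧ IsCritical φ)) ∧
      -- every critical state that invertible local diagonal operators produce from `ψ` in a limit
      -- is a multiple of `φ` up to a local unitary; there is none if `φ = 0`
      (∀ (d : ℕ → LocalDiagonal n) (χ : FockVector n), (∀ k, (d k).IsInvertible) →
        Tendsto (fun k => (d k).act ψ) atTop (𝓝 χ) → χ ≠ 0 → IsCritical χ →
        ∃ (μ : ℂ) (u : LocalDiagonal n), u.IsUnitary ∧ χ = μ • u.act φ) ∧
      -- with operators of determinant one, the limit itself is unique up to a local unitary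
      (∀ (d : ℕ → LocalDiagonal n) (χ : FockVector n), (∀ k, (d k).IsDetOne) →
        Tendsto (fun k => (d k).act ψ) atTop (𝓝 χ) → IsCritical χ →
        ∃ u : LocalDiagonal n, u.IsUnitary ∧ χ = u.act φ) := by
  have hocc := hent.exists_occupation hn
  obtain ⟨φ, r, hlim, hbal, hr, hφ⟩ := exists_tendsto_balancingSequence hψ hocc
  choose e _ he hek _ _ using exists_detOne_balancingSequence hψ hocc
  have hlim' : Tendsto (fun k => (e k).act ψ) atTop (𝓝 φ) := by
    simpa only [← hek] using hlim
  have unique : ∀ (d : ℕ → LocalDiagonal n) (χ : FockVector n), (∀ k, (d k).IsDetOne) →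
      Tendsto (fun k => (d k).act ψ) atTop (𝓝 χ) → IsBalanced (fun x => ‖χ x‖ ^ 2) →
      ∃ u : LocalDiagonal n, u.IsUnitary ∧ χ = u.act φ := fun d χ hd hχ hb =>
    exists_unitary_of_tendsto_act (fun k => (hd k).isInvertible) hχ
      (norm_eq_of_tendsto_act hd he hχ hlim' hb hbal) hr hφ
  refine ⟨φ, fun k => balancingOperator_isDetOne (isFermionicState_balancingSequence hψ hocc k)
    (modeMass_balancingSequence_pos hψ hocc k _), hlim, ?_, ?_,
    fun d χ hd hχ hc => unique d χ hd hχ hc.isBalanced⟩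
  · by_cases h0 : φ = 0
    · exact Or.inl h0
    · have hf : IsFermionicState φ :=
        hψ.of_support h0 fun x hx => right_ne_zero_of_mul (hφ x ▸ hx)
      exact Or.inr ⟨hf, hf.isCritical hbal⟩
  · intro d χ hd hχ h0 hc
    obtain ⟨c, d', hc0, hd', hχ'⟩ := exists_detOne_tendsto hd hχ h0 hc.isBalanced
    -- Rescaling preserves balance, so the determinant-one case applies to `c⁻¹ • χ`, and `c`
    -- becomes the scalar `μ`.
    obtain ⟨u, hu, h⟩ := unique d' (c⁻¹ • χ) hd' hχ' (fun i => by
      have := hc.isBalanced i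
      simp only [Pi.smul_apply, smul_eq_mul, norm_mul, mul_pow, ← Finset.mul_sum]
      rw [this])
    exact ⟨c, u, hu, by rw [← h, smul_inv_smul₀ hc0]⟩
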